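/- **Setting.** For $d,N\ge 1$ let $\mathcal C_N^{(d)}\subset\mathbb Z^d$ be the hypercube of all $\mathbf x$ with $1-\lfloor N/2\rfloor\le x_i\le\lceil N/2\rceil$ for $1\le i\le d$; let $\mathcal C_0^{(d)}=\emptyset$. Let $\Delta f(\mathbf x)=-2d\,f(\mathbf x)+\sum_{|\mathbf y-\mathbf x|=1}f(\mathbf y)$ be the graph Laplacian on $\mathcal C_N^{(d)}$ with dissipating boundary, i.e. $f:=0$ outside $\mathcal C_N^{(d)}$; here $|\cdot|$ is the $\ell_1$ norm. Parallel toppling starts from $s_0\equiv 2d$, $v_0\equiv 0$ on $\mathcal C_N^{(d)}$, and for $t\ge 0$ $$v_{t+1}=v_t+1\{s_t\ge 2d\},\qquad s_{t+1}=s_t+\Delta(v_{t+1}-v_t).$$ Write $v_t^{(d,N)}$ for the odometer and $v_\infty^{(d,N)}=\sup_t v_t^{(d,N)}$ for the final odometer. Let $\partial\mathcal C_i^{(d)}$ be the set of $\mathbf x\in\mathcal C_i^{(d)}$ having some $\mathbf y\notin\mathcal C_i^{(d)}$ with $|\mathbf y-\mathbf x|=1$, and for $j\ge 0$ let $$\tau_j=\tau_j^{(d)}:=\min\{t\ge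 1:\ v_t^{(d,2j)}(\mathbf x)\ge j\text{ for some }\mathbf x\in\partial\mathcal C_{2j}^{(d)}\}$$ ($\min\emptyset=\infty$). Inequalities between vectors and scalars, and adding or subtracting a scalar, are meant coordinatewise. **Theorem 1.** Let $N\ge 1$, $d\ge 2$, $M=\lceil N/2\rceil$, and let $\mathcal S_M^{(d)}=\{(x_1,\dots,x_d)\in\mathbb Z^d: M\ge x_1\ge\cdots\ge x_d\ge 1\}$ be the sorted fundamental domain. 1. (Dimensional reduction) For all $t\ge 1$ and $\mathbf x_{d-1}\in\mathcal S_M^{(d-1)}$, $$v_t^{(d,N)}(\mathbf x_{d-1},1)=v_t^{(d-1,N)}(\mathbf x_{d-1}).$$ Moreover both processes stop, that is, $v_t^{(d,N)}=v_\infty^{(d,N)}$ and $v_t^{(d-1,N)}=v_\infty^{(d-1,N)}$ for all large $t$, and for all $\mathbf x_{d-1}\in\mathcal S_M^{(d-1)}$ with $\mathbf x_{d-1}\ge 2$, $$v_\infty^{(d,N)}(\mathbf x_{d-1},2)=v_\infty^{(d-1,N)}(\mathbf x_{d-1}).$$ 2. (Self-similarity) For all integers $0\le j<M$, the time $\tau_j$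 is finite if $j\ge 1$, and for all $t\le\tau_j$ and all $\mathbf x\in\mathcal S_M^{(d)}$ with $\mathbf x>M-j$, $$v_t^{(d,N)}(\mathbf x)=v_t^{(d,2j)}(\mathbf x-(M-j)).$$ -/

import Mathlib

namespace Sandpile

/-- The hypercube `C_N^(d)` of side length `N`. In each coordinate it is the interval
`1 - ⌊N/2⌋, …, ⌈N/2⌉` of `N` consecutive integers, i.e. `1 - k, …, k` if `N = 2k`
and `1 - k, …, 1 + k` if `N = 2k + 1`. -/
def hypercube (d N : ℕ) : Set (Fin d → ℤ) :=
  {x | ∀ i, 1 - ((N / 2 : ℕ) : ℤ) ≤ x i ∧ x i ≤ (((N + 1) / 2 : ℕ) : ℤ)}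

/-- The graph Laplacian on the hypercube with dissipating boundary conditions:
`f` is padded by `0` outside the hypercube and the sum runs over the `2d` nearest neighbours
of `x` in `ℤ^d`. -/
noncomputable def laplacian (d N : ℕ) (f : (Fin d → ℤ) → ℤ) (x : Fin d → ℤ) : ℤ :=
  -2 * (d : ℤ) * (hypercube d N).indicator f x +
    ∑ i : Fin d, ((hypercube d N).indicator f (x + Pi.single i 1) +
      (hypercube d N).indicator f (x - Pi.single i 1))

/-- The unstable sites of a sandpile on the hypercube: those carrying at least `2d` chips. -/
def unstable (d N : ℕ) (s : (Fin d → ℤ) → ℤ) : Set (Fin d → ℤ) :=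
  {x | x ∈ hypercube d N ∧ 2 * (d : ℤ) ≤ s x}

/-- One parallel toppling step, with dissipation at the boundary. Sandpiles are padded by `0`
outside the hypercube. -/
noncomputable def step (d N : ℕ) (s : (Fin d → ℤ) → ℤ) : (Fin d → ℤ) → ℤ :=
  (hypercube d N).indicator (s + laplacian d N ((unstable d N s).indicator 1))

/-- The sandpile `s_t^(d,N)` of the parallel toppling process started from `s_0 ≡ 2d`. -/
noncomputable def sandpile (d N : ℕ) : ℕ → (Fin d → ℤ) → ℤ
  | 0 => (hypercube d N).indicator fun _ => 2 * (d : ℤ)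
  | t + 1 => step d N (sandpile d N t)

/-- The odometer `v_t^(d,N)`: the number of topples at each site up to time `t`
(padded by `0` outside the hypercube). -/
noncomputable def odometer (d N : ℕ) : ℕ → (Fin d → ℤ) → ℕ
  | 0 => 0
  | t + 1 => odometer d N t + (unstable d N (sandpile d N t)).indicator 1

/-- The final odometer `v_∞^(d,N)`, the supremum of the nondecreasing sequence `v_t^(d,N)`. -/
noncomputable def finalOdometer (d N : ℕ) (x : Fin d → ℤ) : ℕ :=
  ⨆ t, odometer d N t x

/-- The sorted fundamental domain `S_M^(d)`: `M ≥ x_1 ≥ ⋯ ≥ x_d ≥ 1`. -/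
def sortedDomain (d M : ℕ) : Set (Fin d → ℤ) :=
  {x | Antitone x ∧ ∀ i, 1 ≤ x i ∧ x i ≤ (M : ℤ)}

/-- The inner boundary of the hypercube. -/
def innerBoundary (d N : ℕ) : Set (Fin d → ℤ) :=
  {x | x ∈ hypercube d N ∧ ∃ y, y ∉ hypercube d N ∧ ∑ i, |y i - x i| = 1}

/-- `τ_j` in dimension `d`: the first time `t ≥ 1` at which some site of the inner boundary of
the hypercube of side length `2j` has toppled at least `j` times (`⊤` if there is no such time). -/
noncomputable def tau (d j : ℕ) : ℕ∞ :=
  ⨅ t ∈ {t : ℕ | 1 ≤ t ∧ ∃ x ∈ innerBoundary d (2 * j), j ≤ odometer d (2 * j) t x}, (t : ℕ∞)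

/-- The point `(x, a)` obtained by appending one coordinate at the end. -/
def append {n : ℕ} (x : Fin n → ℤ) (a : ℤ) : Fin (n + 1) → ℤ :=
  Fin.snoc (α := fun _ => ℤ) x a

end Sandpile

/-! The sandpile is `2d` plus the Laplacian of the odometer `v`, so a site of the cube topples
exactly when that Laplacian is nonnegative. Most bounds follow by inspecting a first violation: the
bound is tight there, one site topples while another rests, and comparing their Laplacians makes the
resting one topple as well.

Once a site has rested it never topples twice in a row (`no_consecutive_topples`). Hence the drop of
`v` from `x` to `x + e_i` is at most `x i` (`intOdometer_succ_le_add`), and at most `x i - 1` after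
a delay of one step if some coordinate exceeds `x i` (`intOdometer_le_succ_add`). For `x i = 1` the
latter drop is zero: the neighbour off the central slice lags by at most one step and never holds
the slice back, so the slice evolves as the lower-dimensional process (`intOdometer_insertNth_one`).
The terminal values on slices 1 and 2 agree for the same reason.

In dimension one, topples follow a checkerboard, which hides the cut between the two intervals until
the end of the small one has toppled `j` times (`lineOdometer_self_similar`). In higher dimension
the half-side is lowered one unit at a time: the neighbours lost in the cut then lie on central
slices, where dimensional reduction applies (`SelfSimilar.succ_dim`). -/

namespace Sandpile

/-! ### The toppling rule in terms of the odometer -/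

/-- The unit vector in direction `i`. -/
abbrev unitVec {d : ℕ} (i : Fin d) : Fin d → ℤ := Pi.single i 1

/-- The graph Laplacian on `ℤ^d`, without boundary. -/
def latticeLaplacian {d : ℕ} (f : (Fin d → ℤ) → ℤ) (x : Fin d → ℤ) : ℤ :=
  ∑ i, (f (x + unitVec i) + f (x - unitVec i) - 2 * f x)

/-- The odometer with values in `ℤ`. -/
noncomputable def intOdometer (d N t : ℕ) (x : Fin d → ℤ) : ℤ := odometer d N t x

lemma latticeLaplacian_add {d : ℕ} (f g : (Fin d → ℤ) → ℤ) (x : Fin d → ℤ) :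
    latticeLaplacian (f + g) x = latticeLaplacian f x + latticeLaplacian g x := by
  simp only [latticeLaplacian, ← Finset.sum_add_distrib, Pi.add_apply]
  exact Finset.sum_congr rfl fun i _ => by ring

lemma latticeLaplacian_le {d : ℕ} {f g : (Fin d → ℤ) → ℤ} {x y : Fin d → ℤ}
    (h : ∀ i, f (x + unitVec i) + f (x - unitVec i) - 2 * f x ≤
      g (y + unitVec i) + g (y - unitVec i) - 2 * g y) :
    latticeLaplacian f x ≤ latticeLaplacian g y :=
  Finset.sum_le_sum fun i _ => h i

lemma laplacian_indicator {d N : ℕ} {s : Set (Fin d → ℤ)} (hs : s ⊆ hypercube d N)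
    (x : Fin d → ℤ) :
    laplacian d N (s.indicator 1) x = latticeLaplacian (s.indicator 1) x := by
  have h : (hypercube d N).indicator (s.indicator (1 : (Fin d → ℤ) → ℤ)) = s.indicator 1 := by
    rw [Set.indicator_indicator, Set.inter_eq_right.2 hs]
  simp only [laplacian, latticeLaplacian, h, Finset.sum_sub_distrib, Finset.sum_const,
    Finset.card_univ, Fintype.card_fin, nsmul_eq_mul]
  ring

lemma intOdometer_succ_eq (d N t : ℕ) : intOdometer d N (t + 1) =
    intOdometer d N t + (unstable d N (sandpile d N t)).indicator 1 := by
  funext x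
  by_cases h : x ∈ unstable d N (sandpile d N t) <;> simp [intOdometer, odometer, h]

/-- Toppling acts linearly, so the chips can be forgotten and the process becomes a recursion for
the odometer alone. -/
lemma sandpile_eq (d N t : ℕ) : sandpile d N t = (hypercube d N).indicator
    fun x => 2 * (d : ℤ) + latticeLaplacian (intOdometer d N t) x := by
  induction t with
  | zero =>
    simp [sandpile, latticeLaplacian, intOdometer, odometer]
  | succ t ih =>
    funext x
    by_cases hx : x ∈ hypercube d N
    · have hs : unstable d N (sandpile d N t) ⊆ hypercube d N := fun y hy => hy.1
      simp only [sandpile, step, Set.indicator_of_mem hx, Pi.add_apply, intOdometer_succ_eq,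
        latticeLaplacian_add, laplacian_indicator hs]
      rw [congrFun ih x, Set.indicator_of_mem hx]
      ring
    · simp [sandpile, step, hx]

variable {d N t : ℕ} {x : Fin d → ℤ}

lemma mem_unstable_iff : x ∈ unstable d N (sandpile d N t) ↔
    x ∈ hypercube d N ∧ 0 ≤ latticeLaplacian (intOdometer d N t) x := by
  simp only [unstable, Set.mem_ofPred_eq]
  refine and_congr_right fun hx => ?_
  rw [sandpile_eq, Set.indicator_of_mem hx]
  constructor <;> intro h <;> linarith

lemma intOdometer_zero : intOdometer d N 0 x = 0 := by simp [intOdometer, odometer]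

lemma intOdometer_nonneg : 0 ≤ intOdometer d N t x := Int.natCast_nonneg _

lemma intOdometer_succ_of (hx : x ∈ hypercube d N)
    (h : 0 ≤ latticeLaplacian (intOdometer d N t) x) :
    intOdometer d N (t + 1) x = intOdometer d N t x + 1 := by
  rw [intOdometer_succ_eq, Pi.add_apply, Set.indicator_of_mem (mem_unstable_iff.2 ⟨hx, h⟩)]
  rfl

lemma intOdometer_succ_of_not
    (h : ¬ (x ∈ hypercube d N ∧ 0 ≤ latticeLaplacian (intOdometer d N t) x)) :
    intOdometer d N (t + 1) x = intOdometer d N t x := by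
  rw [intOdometer_succ_eq, Pi.add_apply,
    Set.indicator_of_notMem fun h' => h (mem_unstable_iff.1 h')]
  simp

lemma topples_of_ne (h : intOdometer d N (t + 1) x ≠ intOdometer d N t x) :
    x ∈ hypercube d N ∧ 0 ≤ latticeLaplacian (intOdometer d N t) x :=
  by_contra fun h' => h (intOdometer_succ_of_not h')

lemma intOdometer_succ_cases : intOdometer d N (t + 1) x = intOdometer d N t x ∨
    intOdometer d N (t + 1) x = intOdometer d N t x + 1 := by
  by_cases h : x ∈ hypercube d N ∧ 0 ≤ latticeLaplacian (intOdometer d N t) x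
  · exact Or.inr (intOdometer_succ_of h.1 h.2)
  · exact Or.inl (intOdometer_succ_of_not h)

lemma intOdometer_of_notMem (hx : x ∉ hypercube d N) : intOdometer d N t x = 0 := by
  induction t with
  | zero => exact intOdometer_zero
  | succ t ih => rw [intOdometer_succ_of_not fun h => hx h.1, ih]

lemma intOdometer_le_time : intOdometer d N t x ≤ t := by
  induction t with
  | zero => exact intOdometer_zero.le
  | succ t ih => have := intOdometer_succ_cases (d := d) (N := N) (t := t) (x := x); omega

lemma intOdometer_one (hx : x ∈ hypercube d N) : intOdometer d N 1 x = 1 := by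
  rw [intOdometer_succ_of hx, intOdometer_zero, zero_add]
  simp [latticeLaplacian, intOdometer_zero]

/-- A site whose Laplacian dominates that of a toppling site topples. -/
lemma topples_of_le {d' N' s : ℕ} {y : Fin d' → ℤ} (hy : y ∈ hypercube d' N')
    (hx : intOdometer d N (t + 1) x ≠ intOdometer d N t x)
    (h : latticeLaplacian (intOdometer d N t) x ≤ latticeLaplacian (intOdometer d' N' s) y) :
    intOdometer d' N' (s + 1) y = intOdometer d' N' s y + 1 :=
  intOdometer_succ_of hy ((topples_of_ne hx).2.trans h)

/-! ### Symmetries -/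

/-- Symmetries of the hypercube are symmetries of the odometer. -/
lemma intOdometer_symm {φ : (Fin d → ℤ) → (Fin d → ℤ)}
    (hφ : ∀ x, φ x ∈ hypercube d N ↔ x ∈ hypercube d N)
    (hL : ∀ (f : (Fin d → ℤ) → ℤ) x,
      latticeLaplacian (fun y => f (φ y)) x = latticeLaplacian f (φ x)) (t : ℕ) (x : Fin d → ℤ) :
    intOdometer d N t (φ x) = intOdometer d N t x := by
  induction t generalizing x with
  | zero => simp [intOdometer_zero]
  | succ t ih =>
    have h : latticeLaplacian (intOdometer d N t) (φ x) =
        latticeLaplacian (intOdometer d N t) x := by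
      rw [← hL]; simp only [ih]
    by_cases hx : x ∈ hypercube d N ∧ 0 ≤ latticeLaplacian (intOdometer d N t) x
    · rw [intOdometer_succ_of hx.1 hx.2, intOdometer_succ_of ((hφ x).2 hx.1) (h ▸ hx.2), ih]
    · rw [intOdometer_succ_of_not hx, intOdometer_succ_of_not, ih]
      rwa [hφ, h]

lemma intOdometer_swap (i j : Fin d) (x : Fin d → ℤ) :
    intOdometer d N t (x ∘ Equiv.swap i j) = intOdometer d N t x := by
  refine intOdometer_symm (φ := fun x => x ∘ Equiv.swap i j) (fun x => ?_) (fun f x => ?_) t x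
  · simp only [hypercube, Set.mem_ofPred_eq, Function.comp_apply]
    exact (Equiv.swap i j).forall_congr_right (q := fun a => 1 - ((N / 2 : ℕ) : ℤ) ≤ x a ∧
      x a ≤ (((N + 1) / 2 : ℕ) : ℤ))
  · have h (k : Fin d) : unitVec k ∘ Equiv.swap i j = unitVec (Equiv.swap i j k) := by
      funext a
      simp only [unitVec, Function.comp_apply, Pi.single_apply]
      congr 1
      rw [Equiv.swap_apply_eq_iff]
    have h1 (k : Fin d) : (x + unitVec k) ∘ Equiv.swap i j =
        x ∘ Equiv.swap i j + unitVec (Equiv.swap i j k) := by rw [← h]; rfl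
    have h2 (k : Fin d) : (x - unitVec k) ∘ Equiv.swap i j =
        x ∘ Equiv.swap i j - unitVec (Equiv.swap i j k) := by rw [← h]; rfl
    simp only [latticeLaplacian, h1, h2]
    exact Equiv.sum_comp (Equiv.swap i j) fun k => f (x ∘ Equiv.swap i j + unitVec k) +
      f (x ∘ Equiv.swap i j - unitVec k) - 2 * f (x ∘ Equiv.swap i j)

/-- The reflection of the hypercube in direction `i`. -/
def reflect (N : ℕ) (i : Fin d) (x : Fin d → ℤ) : Fin d → ℤ :=
  Function.update x i (1 + ((N % 2 : ℕ) : ℤ) - x i)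

lemma intOdometer_reflect (i : Fin d) (x : Fin d → ℤ) :
    intOdometer d N t (reflect N i x) = intOdometer d N t x := by
  refine intOdometer_symm (φ := reflect N i) (fun x => ?_) (fun f x => ?_) t x
  · simp only [hypercube, Set.mem_ofPred_eq]
    refine forall_congr' fun k => ?_
    by_cases hk : k = i
    · subst hk
      simp only [reflect, Function.update_self]
      omega
    · simp [reflect, hk]
  · refine Finset.sum_congr rfl fun k _ => ?_
    by_cases hk : k = i
    · subst hk
      have h1 : reflect N k (x + unitVec k) = reflect N k x - unitVec k := by
        funext a
        by_cases ha : a = k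
        · subst ha; simp [reflect]; ring
        · simp [reflect, ha]
      have h2 : reflect N k (x - unitVec k) = reflect N k x + unitVec k := by
        funext a
        by_cases ha : a = k
        · subst ha; simp [reflect]; ring
        · simp [reflect, ha]
      simp only [h1, h2]; ring
    · have h1 : reflect N i (x + unitVec k) = reflect N i x + unitVec k := by
        funext a
        by_cases ha : a = i
        · subst ha; simp [reflect, Ne.symm hk]
        · simp [reflect, ha]
      have h2 : reflect N i (x - unitVec k) = reflect N i x - unitVec k := by
        funext a
        by_cases ha : a = i
        · subst ha; simp [reflect, Ne.symm hk]
        · simp [reflect, ha]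
      simp only [h1, h2]

/-- The central reflection is `a ↦ 1 - a` for even `N` and `a ↦ 2 - a` for odd `N`, so coordinate 0
mirrors 1 or 2 respectively. -/
lemma intOdometer_sub_of_even (hN : N % 2 = 0) {i : Fin d} (hx : x i = 1) :
    intOdometer d N t (x - unitVec i) = intOdometer d N t x := by
  rw [← intOdometer_reflect i x]
  congr 1
  funext a
  by_cases ha : a = i
  · subst ha; simp [reflect, hN, hx]
  · simp [reflect, ha]

lemma intOdometer_sub_of_odd (hN : N % 2 = 1) {i : Fin d} (hx : x i = 1) :
    intOdometer d N t (x - unitVec i) = intOdometer d N t (x + unitVec i) := by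
  rw [← intOdometer_reflect i (x + unitVec i)]
  congr 1
  funext a
  by_cases ha : a = i
  · subst ha; simp [reflect, hN, hx]
  · simp [reflect, ha]

/-! ### Monotonicity and the quadratic barrier -/

/-- The odometer decreases away from the centre. -/
lemma intOdometer_add_le {i : Fin d} (hx : 1 ≤ x i) :
    intOdometer d N t (x + unitVec i) ≤ intOdometer d N t x := by
  induction t generalizing x with
  | zero => simp [intOdometer_zero]
  | succ t ih =>
    by_contra! hlt
    have h1 := ih hx
    have h2 := intOdometer_succ_cases (d := d) (N := N) (t := t) (x := x)
    have h3 := intOdometer_succ_cases (d := d) (N := N) (t := t) (x := x + unitVec i)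
    have htop : intOdometer d N (t + 1) (x + unitVec i) ≠ intOdometer d N t (x + unitVec i) := by
      omega
    have hmem : x ∈ hypercube d N := by
      intro k
      have := (topples_of_ne htop).1 k
      by_cases hk : k = i
      · subst hk; simp at this; omega
      · simpa [hk] using this
    -- Before the violation the two values are equal, so every directional term at `x` dominates the
    -- one at `x + e_i`, and `x` topples too.
    have := topples_of_le (s := t) hmem htop (latticeLaplacian_le fun k => ?_)
    · omega
    by_cases hk : k = i
    · subst hk
      have e1 : x + unitVec k - unitVec k = x := by simp
      have h4 := ih (x := x + unitVec k) (by simp; omega)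
      rw [e1]
      have h5 : intOdometer d N t x ≤ intOdometer d N t (x - unitVec k) := by
        rcases eq_or_lt_of_le hx with h | h
        · rcases Nat.mod_two_eq_zero_or_one N with hN | hN
          · rw [intOdometer_sub_of_even hN h.symm]
          · rw [intOdometer_sub_of_odd hN h.symm]; omega
        · have := ih (x := x - unitVec k) (by simp; omega)
          rwa [sub_add_cancel] at this
      omega
    · have h4 := ih (x := x + unitVec k) (by simp [Ne.symm hk, hx])
      have h5 := ih (x := x - unitVec k) (by simp [Ne.symm hk, hx])
      rw [add_right_comm] at h4
      rw [sub_add_eq_add_sub] at h5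
      omega

lemma intOdometer_sub_le_of_eq_one {i : Fin d} (hx : x i = 1) :
    intOdometer d N t (x - unitVec i) ≤ intOdometer d N t x := by
  rcases Nat.mod_two_eq_zero_or_one N with hN | hN
  · rw [intOdometer_sub_of_even hN hx]
  · rw [intOdometer_sub_of_odd hN hx]
    exact intOdometer_add_le hx.ge

lemma intOdometer_mono {s : ℕ} (h : t ≤ s) :
    intOdometer d N t x ≤ intOdometer d N s x := by
  induction s, h using Nat.le_induction with
  | base => exact le_rfl
  | succ s _ ih =>
    have := intOdometer_succ_cases (d := d) (N := N) (t := s) (x := x)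
    omega

/-- The one-dimensional final odometer is a barrier in every dimension. -/
lemma two_mul_intOdometer_le {M : ℕ} (hM : M = (N + 1) / 2) (hx : x ∈ hypercube d N) (l : Fin d) :
    2 * intOdometer d N t x ≤ M * (M + 1) - x l * (x l - 1) := by
  have hnn (a : ℤ) (h1 : -(M : ℤ) ≤ a) (h2 : a ≤ M + 1) : 0 ≤ (M : ℤ) * (M + 1) - a * (a - 1) := by
    nlinarith
  induction t generalizing x with
  | zero =>
    rw [intOdometer_zero]
    have := hx l
    have := hnn (x l) (by omega) (by omega)
    omega
  | succ t ih =>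
    have h1 := ih hx
    by_contra! hlt
    have h2 := intOdometer_succ_cases (d := d) (N := N) (t := t) (x := x)
    have htop := (topples_of_ne (d := d) (N := N) (t := t) (x := x) (by omega)).2
    -- Both sides are even, so a single topple breaks the bound only from equality.
    obtain ⟨a, ha⟩ := Int.even_mul_succ_self (M : ℤ)
    obtain ⟨b, hb⟩ := Int.even_mul_pred_self (x l)
    have heq : 2 * intOdometer d N t x = M * (M + 1) - x l * (x l - 1) := by omega
    have key (y : Fin d → ℤ) (h1 : -(M : ℤ) ≤ y l) (h2 : y l ≤ M + 1) :
        2 * intOdometer d N t y ≤ M * (M + 1) - y l * (y l - 1) := by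
      by_cases hy : y ∈ hypercube d N
      · exact ih hy
      · rw [intOdometer_of_notMem hy, mul_zero]
        exact hnn _ h1 h2
    have hxl := hx l
    -- The barrier is strictly concave in direction `l` and constant in the others, so contact
    -- forces a negative Laplacian.
    have hneg : latticeLaplacian (intOdometer d N t) x < ∑ _i : Fin d, 0 := by
      refine Finset.sum_lt_sum (fun k _ => ?_) ⟨l, Finset.mem_univ _, ?_⟩
      · by_cases hk : k = l
        · subst hk
          have h3 := key (x + unitVec k) (by simp; omega) (by simp; omega)
          have h4 := key (x - unitVec k) (by simp; omega) (by simp; omega)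
          simp at h3 h4
          nlinarith
        · have h3 := key (x + unitVec k) (by simp [Ne.symm hk]; omega) (by simp [Ne.symm hk]; omega)
          have h4 := key (x - unitVec k) (by simp [Ne.symm hk]; omega) (by simp [Ne.symm hk]; omega)
          simp [Ne.symm hk] at h3 h4
          omega
      · have h3 := key (x + unitVec l) (by simp; omega) (by simp; omega)
        have h4 := key (x - unitVec l) (by simp; omega) (by simp; omega)
        simp at h3 h4
        nlinarith
    simp at hneg
    omega

lemma intOdometer_le_of_eq {M : ℕ} (hM : M = (N + 1) / 2) {l : Fin d} (hx : x l = M) :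
    intOdometer d N t x ≤ M := by
  by_cases h : x ∈ hypercube d N
  · have := two_mul_intOdometer_le (t := t) hM h l
    rw [hx] at this
    nlinarith
  · rw [intOdometer_of_notMem h]
    positivity

/-! ### Flat sites and resting -/

/-- No value exceeds the time, so a nonnegative Laplacian at a maximal site forces its neighbours to
be maximal. -/
lemma intOdometer_eq_succ_of_neighbour (h : intOdometer d N (t + 1 + 1) x = t + 2) (i : Fin d) :
    intOdometer d N (t + 1) (x + unitVec i) = t + 1 ∧
    intOdometer d N (t + 1) (x - unitVec i) = t + 1 := by
  have hle (y : Fin d → ℤ) : intOdometer d N (t + 1) y ≤ t + 1 := by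
    exact_mod_cast intOdometer_le_time (d := d) (N := N) (t := t + 1) (x := y)
  have h1 := intOdometer_succ_cases (d := d) (N := N) (t := t + 1) (x := x)
  have h2 := hle x
  have htop := (topples_of_ne (d := d) (N := N) (t := t + 1) (x := x) (by omega)).2
  have hx : intOdometer d N (t + 1) x = t + 1 := by omega
  have hterm (k : Fin d) : intOdometer d N (t + 1) (x + unitVec k) +
      intOdometer d N (t + 1) (x - unitVec k) - 2 * intOdometer d N (t + 1) x ≤ 0 := by
    have := hle (x + unitVec k); have := hle (x - unitVec k); omega
  have hzero := (Finset.sum_eq_zero_iff_of_nonpos fun k _ => hterm k).1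
    (le_antisymm (Finset.sum_nonpos fun k _ => hterm k) htop) i (Finset.mem_univ _)
  have := hle (x + unitVec i); have := hle (x - unitVec i); omega

/-- The sites which have toppled at every step up to time `t + 1`. -/
lemma intOdometer_succ_eq_iff : intOdometer d N (t + 1) x = t + 1 ↔
    ∀ i, 1 - ((N / 2 : ℕ) : ℤ) + t ≤ x i ∧ x i ≤ (((N + 1) / 2 : ℕ) : ℤ) - t := by
  induction t generalizing x with
  | zero =>
    simp only [Nat.cast_zero, zero_add, add_zero, sub_zero]
    constructor
    · intro h
      exact (topples_of_ne (t := 0) (by rw [h, intOdometer_zero]; simp)).1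
    · exact fun h => intOdometer_one h
  | succ t ih =>
    constructor
    · intro h i
      have h' : intOdometer d N (t + 1 + 1) x = t + 2 := by push_cast at h; linarith
      have h1 := ih.1 (intOdometer_eq_succ_of_neighbour h' i).1 i
      have h2 := ih.1 (intOdometer_eq_succ_of_neighbour h' i).2 i
      simp at h1 h2
      push_cast
      omega
    · intro h
      have hnb (y : Fin d → ℤ) (hy : ∀ i, x i - 1 ≤ y i ∧ y i ≤ x i + 1) :
          intOdometer d N (t + 1) y = t + 1 := ih.2 fun i => by
        have := h i; have := hy i; push_cast at *; omega
      have h0 := hnb x fun i => by omega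
      rw [intOdometer_succ_of, h0]
      · push_cast; ring
      · intro i; have := h i; push_cast at *; omega
      · refine Finset.sum_nonneg fun k _ => ?_
        rw [hnb (x + unitVec k), hnb (x - unitVec k), h0]
        · omega
        all_goals
          intro i
          by_cases hk : i = k
          · subst hk; simp; try omega
          · simp [hk]

/-- After its first rest a site never topples at two consecutive times. -/
lemma no_consecutive_topples (t : ℕ) (x : Fin d → ℤ) : intOdometer d N (t + 1) x = t + 1 ∨
    intOdometer d N (t + 1 + 1) x ≤ intOdometer d N t x + 1 := by
  induction t generalizing x with
  | zero =>
    by_cases hx : x ∈ hypercube d N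
    · left; simp [intOdometer_one hx]
    · right; simp [intOdometer_of_notMem hx]
  | succ t ih =>
    by_cases hflat : intOdometer d N (t + 1 + 1) x = t + 2
    · left; push_cast; linarith
    right
    have hc (s) := intOdometer_succ_cases (d := d) (N := N) (t := s) (x := x)
    have h0 := hc t; have h1 := hc (t + 1); have h2 := hc (t + 1 + 1)
    have hle := intOdometer_le_time (d := d) (N := N) (t := t) (x := x)
    change intOdometer d N (t + 1 + 1 + 1) x ≤ _
    by_contra! hlt
    have hflat' : intOdometer d N (t + 1) x ≠ t + 1 := by
      intro h; omega
    have hx : intOdometer d N (t + 1 + 1) x ≤ intOdometer d N t x + 1 := (ih x).resolve_left hflat'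
    -- Like `x`, each neighbour gains at most one in two steps, since a neighbour that never rested
    -- would force `x` to be flat. Thus the Laplacian at `x` at time `t + 2` is at most that at time
    -- `t`, and `x` toppled at time `t` already.
    have hnb (y : Fin d → ℤ) (h : intOdometer d N (t + 1 + 1) y = t + 2 →
        intOdometer d N (t + 1) x = t + 1) :
        intOdometer d N (t + 1 + 1) y ≤ intOdometer d N t y + 1 := by
      rcases ih y with hy | hy
      · have h3 := intOdometer_succ_cases (d := d) (N := N) (t := t) (x := y)
        have h4 := intOdometer_succ_cases (d := d) (N := N) (t := t + 1) (x := y)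
        have h5 : intOdometer d N (t + 1 + 1) y ≠ t + 2 := fun h' => hflat' (h h')
        omega
      · exact hy
    have htop : intOdometer d N (t + 1 + 1 + 1) x ≠ intOdometer d N (t + 1 + 1) x := by
      omega
    have := topples_of_le (t := t + 1 + 1) (s := t) (topples_of_ne htop).1 htop
      (latticeLaplacian_le fun k => ?_)
    · omega
    have h3 := hnb (x + unitVec k) fun h => by
      have := (intOdometer_eq_succ_of_neighbour h k).2; rwa [add_sub_cancel_right] at this
    have h4 := hnb (x - unitVec k) fun h => by
      have := (intOdometer_eq_succ_of_neighbour h k).1; rwa [sub_add_cancel] at this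
    omega

/-! ### Slope bounds -/

/-- Two adjacent values, at two consecutive times, differ by at most the coordinate. -/
lemma intOdometer_succ_le_add (t : ℕ) (x : Fin d → ℤ) (l : Fin d) (hx : 1 ≤ x l) :
    intOdometer d N (t + 1) x ≤ intOdometer d N t (x + unitVec l) + x l := by
  induction t generalizing x with
  | zero =>
    have := intOdometer_le_time (d := d) (N := N) (t := 1) (x := x)
    rw [intOdometer_zero]
    push_cast at *
    omega
  | succ t ih =>
    have h1 := ih x hx
    have h2 := intOdometer_succ_cases (d := d) (N := N) (t := t) (x := x + unitVec l)
    have h3 := intOdometer_succ_cases (d := d) (N := N) (t := t + 1) (x := x)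
    by_contra! hlt
    have htop : intOdometer d N (t + 1 + 1) x ≠ intOdometer d N (t + 1) x := by omega
    have hmem := (topples_of_ne htop).1
    rcases (hmem l).2.eq_or_lt with hl | hl
    · have h4 := intOdometer_le_of_eq (d := d) (N := N) (t := t + 1 + 1) rfl hl
      have := intOdometer_nonneg (d := d) (N := N) (t := t + 1) (x := x + unitVec l)
      omega
    have hmem' : x + unitVec l ∈ hypercube d N := fun k => by
      have := hmem k
      by_cases hk : k = l
      · subst hk; simp; omega
      · simpa [hk] using this
    rcases no_consecutive_topples (N := N) t x with hflat | hnc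
    · have := (intOdometer_eq_succ_of_neighbour (d := d) (N := N) (t := t) (x := x)
        (by omega) l).1
      omega
    have h4 := intOdometer_succ_cases (d := d) (N := N) (t := t) (x := x)
    -- The allowed drop is linear in the coordinate, hence harmonic, so the tight bound at `x`
    -- compares the two Laplacians.
    have := topples_of_le (s := t) hmem' htop (latticeLaplacian_le fun k => ?_)
    · omega
    by_cases hk : k = l
    · subst hk
      have h5 := ih (x + unitVec k) (by simp; omega)
      have h6 : intOdometer d N (t + 1) (x - unitVec k) ≤
          intOdometer d N t x + (x k - 1) := by
        -- At coordinate 1 the induction hypothesis is unavailable; reflection and the rest of `x`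
        -- at time `t` replace it.
        rcases hx.eq_or_lt with h | h
        · have := intOdometer_sub_le_of_eq_one (d := d) (N := N) (t := t + 1) h.symm
          omega
        · have := ih (x - unitVec k) (by simp; omega)
          rw [sub_add_cancel] at this
          simpa using this
      simp only [Pi.add_apply, Pi.single_eq_same] at h5
      rw [add_sub_cancel_right]
      omega
    · have h5 := ih (x + unitVec k) (by simp [Ne.symm hk, hx])
      have h6 := ih (x - unitVec k) (by simp [Ne.symm hk, hx])
      rw [add_right_comm x] at h5
      rw [sub_add_eq_add_sub] at h6
      simp [Ne.symm hk] at h5 h6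
      omega

lemma intOdometer_le_add (x : Fin d → ℤ) (l : Fin d) (hx : 1 ≤ x l) :
    intOdometer d N t x ≤ intOdometer d N t (x + unitVec l) + x l := by
  have := intOdometer_succ_le_add (N := N) t x l hx
  have := intOdometer_succ_cases (d := d) (N := N) (t := t) (x := x)
  omega

lemma comp_swap_eq {i l : Fin d} (h : x l = x i + 1) :
    x ∘ Equiv.swap i l = x + unitVec i - unitVec l := by
  have hil : i ≠ l := fun h' => by subst h'; omega
  funext a
  by_cases ha : a = i
  · subst ha; simp [hil, h]
  by_cases hb : a = l
  · subst hb; simp [Ne.symm hil, h]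
  · simp [ha, hb, Equiv.swap_apply_of_ne_of_ne ha hb]

/-- In a direction which is not the largest, the previous bound improves by one at the cost of
one more time step. -/
lemma intOdometer_le_succ_add (t : ℕ) (x : Fin d → ℤ) {i l : Fin d} (hx : 1 ≤ x i)
    (hil : x i < x l) :
    intOdometer d N t x ≤ intOdometer d N (t + 1) (x + unitVec i) + (x i - 1) := by
  induction t using Nat.strong_induction_on generalizing x with
  | _ t ih =>
  rcases t with _ | t
  · have := intOdometer_nonneg (d := d) (N := N) (t := 0 + 1) (x := x + unitVec i)
    rw [intOdometer_zero]
    omega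
  have hne : i ≠ l := fun h' => by subst h'; omega
  have h1 := ih t (by omega) x hx hil
  have h2 := intOdometer_succ_cases (d := d) (N := N) (t := t) (x := x)
  have h3 := intOdometer_succ_cases (d := d) (N := N) (t := t + 1) (x := x + unitVec i)
  by_contra! hlt
  have htop : intOdometer d N (t + 1) x ≠ intOdometer d N t x := by omega
  have hmem := (topples_of_ne htop).1
  have hmem' : x + unitVec i ∈ hypercube d N := fun k => by
    have := hmem k
    have := hmem l
    by_cases hk : k = i
    · subst hk; simp; omega
    · simpa [hk] using hmem k
  -- The flat region is a product of equal intervals and `x i + 1 ≤ x l`, so it contains `x + e_i`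
  -- along with `x`.
  by_cases hflat : intOdometer d N (t + 1) x = t + 1
  · have hQ := intOdometer_succ_eq_iff.1 hflat
    have : intOdometer d N (t + 1) (x + unitVec i) = t + 1 :=
      intOdometer_succ_eq_iff.2 fun k => by
        have := hQ l
        by_cases hk : k = i
        · subst hk; have := hQ k; simp; omega
        · simpa [hk] using hQ k
    omega
  obtain ⟨s, rfl⟩ : ∃ s, t = s + 1 := by
    rcases t with _ | s
    · exact absurd (by rw [h2.resolve_left htop, intOdometer_zero]; rfl) hflat
    · exact ⟨s, rfl⟩
  have h4 := intOdometer_succ_cases (d := d) (N := N) (t := s) (x := x)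
  have hnc := (no_consecutive_topples (N := N) s x).resolve_left fun h => hflat (by
    push_cast; omega)
  have ih0 := ih (s + 1) (by omega)
  have h5 := ih s (by omega) x hx hil
  have h6 := intOdometer_succ_cases (d := d) (N := N) (t := s + 1) (x := x + unitVec i)
  have := topples_of_le (s := s + 1 + 1) hmem' htop (latticeLaplacian_le fun k => ?_)
  · omega
  by_cases hk : k = i
  · subst hk
    rw [add_sub_cancel_right]
    have h7 : intOdometer d N (s + 1) (x - unitVec k) ≤ intOdometer d N (s + 1) x + (x k - 1) := by
      rcases hx.eq_or_lt with h | h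
      · have := intOdometer_sub_le_of_eq_one (d := d) (N := N) (t := s + 1) h.symm
        omega
      · have := intOdometer_le_add (N := N) (t := s + 1) (x - unitVec k) k (by simp; omega)
        rw [sub_add_cancel] at this
        simpa using this
    have h8 : intOdometer d N (s + 1) x - 2 * x k + 1 ≤
        intOdometer d N (s + 1 + 1) (x + unitVec k + unitVec k) := by
      -- Here `x + 2e_k` is `x + e_k + e_l` with two coordinates exchanged, reached through `x +
      -- e_l` by the full slope bound in direction `l`.
      by_cases hl : x l = x k + 1
      · have h9 := ih0 (x + unitVec l) (by simp [hne, hx]) (by simp [hne]; omega)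
        have h10 := intOdometer_succ_le_add (N := N) (s + 1) x l (by omega)
        have h11 := intOdometer_swap (N := N) (t := s + 1 + 1) k l (x + unitVec l + unitVec k)
        have h12 : (x + unitVec l + unitVec k) ∘ Equiv.swap k l = x + unitVec k + unitVec k := by
          rw [comp_swap_eq (by simp [hne, Ne.symm hne, hl])]
          abel
        rw [h12] at h11
        simp [hne] at h9
        omega
      · have h9 := ih0 (x + unitVec k) (by simp; omega) (by simp [Ne.symm hne]; omega)
        simp at h9
        omega
    omega
  · have h7 := ih0 (x + unitVec k) (by simp [Ne.symm hk, hx]) (by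
      by_cases hkl : k = l
      · subst hkl; simp [Ne.symm hk]; omega
      · simp [Ne.symm hk, Ne.symm hkl, hil])
    have h8 : intOdometer d N (s + 1) (x - unitVec k) - intOdometer d N (s + 1) x ≤
        intOdometer d N (s + 1 + 1) (x + unitVec i - unitVec k) -
          intOdometer d N (s + 1 + 1) (x + unitVec i) := by
      -- In this case `x + e_i - e_l` is `x` with two coordinates exchanged.
      by_cases hkl : k = l ∧ x l = x i + 1
      · obtain ⟨rfl, hl⟩ := hkl
        rw [← comp_swap_eq hl, intOdometer_swap]
        have := intOdometer_le_add (N := N) (t := s + 1) (x - unitVec k) k (by simp; omega)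
        rw [sub_add_cancel] at this
        simp at this
        omega
      · have := ih0 (x - unitVec k) (by simp [Ne.symm hk, hx]) (by
          by_cases hkl' : k = l
          · subst hkl'; simp [Ne.symm hk]; omega
          · simp [Ne.symm hk, Ne.symm hkl', hil])
        rw [sub_add_eq_add_sub] at this
        simp [Ne.symm hk] at this
        omega
    rw [add_right_comm x] at h7
    simp [Ne.symm hk] at h7
    omega

/-! ### Dimensional reduction -/

variable {n : ℕ}

lemma insertNth_add_unitVec (i : Fin (n + 1)) (a : ℤ) (x : Fin n → ℤ) :
    (i.insertNth a x : Fin (n + 1) → ℤ) + unitVec i = i.insertNth (a + 1) x := by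
  funext k
  refine Fin.succAboveCases i ?_ (fun k => ?_) k <;> simp

lemma insertNth_sub_unitVec (i : Fin (n + 1)) (a : ℤ) (x : Fin n → ℤ) :
    (i.insertNth a x : Fin (n + 1) → ℤ) - unitVec i = i.insertNth (a - 1) x := by
  funext k
  refine Fin.succAboveCases i ?_ (fun k => ?_) k <;> simp

lemma insertNth_add_unitVec_succAbove (i : Fin (n + 1)) (a : ℤ) (x : Fin n → ℤ) (k : Fin n) :
    (i.insertNth a x : Fin (n + 1) → ℤ) + unitVec (i.succAbove k) =
      i.insertNth a (x + unitVec k) := by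
  funext j
  refine Fin.succAboveCases i ?_ (fun j => ?_) j <;> simp [Pi.single_apply]

lemma insertNth_sub_unitVec_succAbove (i : Fin (n + 1)) (a : ℤ) (x : Fin n → ℤ) (k : Fin n) :
    (i.insertNth a x : Fin (n + 1) → ℤ) - unitVec (i.succAbove k) =
      i.insertNth a (x - unitVec k) := by
  funext j
  refine Fin.succAboveCases i ?_ (fun j => ?_) j <;> simp [Pi.single_apply]

lemma latticeLaplacian_insertNth (f : (Fin (n + 1) → ℤ) → ℤ) (i : Fin (n + 1)) (a : ℤ)
    (x : Fin n → ℤ) : latticeLaplacian f (i.insertNth a x) =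
      (f (i.insertNth (a + 1) x) + f (i.insertNth (a - 1) x) - 2 * f (i.insertNth a x)) +
        latticeLaplacian (fun y => f (i.insertNth a y)) x := by
  simp only [latticeLaplacian, Fin.sum_univ_succAbove _ i, insertNth_add_unitVec,
    insertNth_sub_unitVec, insertNth_add_unitVec_succAbove, insertNth_sub_unitVec_succAbove]

lemma latticeLaplacian_congr {f g : (Fin d → ℤ) → ℤ} {x : Fin d → ℤ} (h0 : f x = g x)
    (h1 : ∀ i, f (x + unitVec i) = g (x + unitVec i))
    (h2 : ∀ i, f (x - unitVec i) = g (x - unitVec i)) :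
    latticeLaplacian f x = latticeLaplacian g x :=
  Finset.sum_congr rfl fun i _ => by rw [h0, h1, h2]

/-- The toppling rule only depends on membership in the hypercube and the sign of the Laplacian. -/
lemma intOdometer_succ_congr {d' N' : ℕ} {x : Fin d → ℤ} {y : Fin d' → ℤ}
    (h : intOdometer d N t x = intOdometer d' N' t y)
    (hmem : x ∈ hypercube d N ↔ y ∈ hypercube d' N')
    (hL : x ∈ hypercube d N → (0 ≤ latticeLaplacian (intOdometer d N t) x ↔
      0 ≤ latticeLaplacian (intOdometer d' N' t) y)) :
    intOdometer d N (t + 1) x = intOdometer d' N' (t + 1) y := by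
  by_cases hx : x ∈ hypercube d N ∧ 0 ≤ latticeLaplacian (intOdometer d N t) x
  · rw [intOdometer_succ_of hx.1 hx.2, intOdometer_succ_of (hmem.1 hx.1) ((hL hx.1).1 hx.2), h]
  · rw [intOdometer_succ_of_not hx, intOdometer_succ_of_not, h]
    exact fun hy => hx ⟨hmem.2 hy.1, (hL (hmem.2 hy.1)).2 hy.2⟩

/-- The odometer in dimension `n` is the central slice of the odometer in dimension `n + 1`. -/
theorem intOdometer_insertNth_one (hN : 1 ≤ N) (hn : 1 ≤ n) (i : Fin (n + 1)) (t : ℕ)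
    (x : Fin n → ℤ) (hx : ∀ k, 1 ≤ x k) :
    intOdometer (n + 1) N t (i.insertNth 1 x) = intOdometer n N t x := by
  induction t using Nat.strong_induction_on generalizing x with
  | _ t ih' =>
    rcases t with _ | t
    · simp [intOdometer_zero]
    have ih := ih' t t.lt_succ_self
    have hadd (k : Fin n) : intOdometer (n + 1) N t (i.insertNth 1 (x + unitVec k)) =
        intOdometer n N t (x + unitVec k) := by
      refine ih _ fun j => ?_
      have h0 : (0 : ℤ) ≤ unitVec k j := by
        simp only [unitVec, Pi.single_apply]; split_ifs <;> simp
      have := hx j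
      rw [Pi.add_apply]; omega
    have hsub (k : Fin n) : intOdometer (n + 1) N t (i.insertNth 1 (x - unitVec k)) =
        intOdometer n N t (x - unitVec k) := by
      rcases (hx k).eq_or_lt with hk | hk
      · have hk' : (i.insertNth (1 : ℤ) x : Fin (n + 1) → ℤ) (i.succAbove k) = 1 := by
          simp [← hk]
        rw [← insertNth_sub_unitVec_succAbove]
        rcases Nat.mod_two_eq_zero_or_one N with h | h
        · rw [intOdometer_sub_of_even h hk.symm, intOdometer_sub_of_even h hk', ih x hx]
        · rw [intOdometer_sub_of_odd h hk.symm, intOdometer_sub_of_odd h hk',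
            insertNth_add_unitVec_succAbove, hadd]
      · refine ih _ fun j => ?_
        by_cases hj : j = k
        · subst hj; simp; omega
        · simpa [hj] using hx j
    have hL : latticeLaplacian (fun y => intOdometer (n + 1) N t (i.insertNth 1 y)) x =
        latticeLaplacian (intOdometer n N t) x := latticeLaplacian_congr (ih x hx) hadd hsub
    have hone : (i.insertNth (1 : ℤ) x : Fin (n + 1) → ℤ) i = 1 := by simp
    have hup := intOdometer_add_le (N := N) (t := t) hone.ge
    have hdown := intOdometer_sub_le_of_eq_one (N := N) (t := t) hone
    have hdown' (h : intOdometer (n + 1) N t (i.insertNth 1 x + unitVec i) =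
        intOdometer (n + 1) N t (i.insertNth 1 x)) :
        intOdometer (n + 1) N t (i.insertNth 1 x - unitVec i) =
          intOdometer (n + 1) N t (i.insertNth 1 x) := by
      rcases Nat.mod_two_eq_zero_or_one N with h' | h'
      · rw [intOdometer_sub_of_even h' hone]
      · rw [intOdometer_sub_of_odd h' hone, h]
    have hdec := latticeLaplacian_insertNth (intOdometer (n + 1) N t) i 1 x
    rw [hL, ← insertNth_add_unitVec, ← insertNth_sub_unitVec] at hdec
    have hmem : (i.insertNth (1 : ℤ) x : Fin (n + 1) → ℤ) ∈ hypercube (n + 1) N ↔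
        x ∈ hypercube n N := by
      simp only [hypercube, Set.mem_ofPred_eq, Fin.forall_iff_succAbove i, Fin.insertNth_apply_same,
        Fin.insertNth_apply_succAbove, and_iff_right_iff_imp]
      omega
    by_cases hflat : intOdometer n N (t + 1) x = t + 1
    · rw [hflat]
      have hQ := intOdometer_succ_eq_iff.1 hflat
      refine intOdometer_succ_eq_iff.2 ((Fin.forall_iff_succAbove i).2 ⟨?_, fun k => ?_⟩)
      · have := hQ ⟨0, hn⟩
        rw [hone]; omega
      · simpa using hQ k
    -- The transverse second difference is nonpositive, so the slice can only be slower; being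
    -- slower requires a strict drop off the slice.
    refine intOdometer_succ_congr (ih x hx) hmem fun hmemx => ⟨fun h => by omega, fun h => ?_⟩
    have htop := intOdometer_succ_of (hmem.1 hmemx) h
    by_contra! hneg
    have hlt : intOdometer (n + 1) N t (i.insertNth 1 x + unitVec i) <
        intOdometer (n + 1) N t (i.insertNth 1 x) :=
      lt_of_le_of_ne hup fun h' => by have := hdown' h'; omega
    by_cases hl : ∃ l, 1 < x l
    · obtain ⟨l, hl⟩ := hl
      rcases t with _ | s
      · rw [htop, intOdometer_zero] at hflat; exact hflat rfl
      -- With constant 0, the value at time `s` is at most the off-slice value at time `s + 1`,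
      -- strictly below the slice value. So `x` topples twice in a row without being flat.
      have h1 := intOdometer_le_succ_add (N := N) s (i.insertNth 1 x) (i := i)
        (l := i.succAbove l) hone.ge (by simpa using hl)
      have h2 := ih' s (by omega) x hx
      have h3 := ih x hx
      have h4 : intOdometer n N s x + 1 ≤ intOdometer n N (s + 1) x := by
        rw [hone] at h1; omega
      rcases no_consecutive_topples (N := N) s x with h5 | h5
      · push_cast at hflat; omega
      · rw [show s + 2 = s + 1 + 1 from rfl] at h5; omega
    -- At `(1, …, 1)` all terms are nonpositive, hence zero, and exchanging coordinates carries one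
    -- of them to the transverse drop.
    · push Not at hl
      have hx1 (k : Fin n) : x k = 1 := le_antisymm (hl k) (hx k)
      have hterm (k : Fin n) := intOdometer_add_le (N := N) (t := t) (hx k)
      have hterm' (k : Fin n) := intOdometer_sub_le_of_eq_one (N := N) (t := t) (hx1 k)
      have hzero := (Finset.sum_eq_zero_iff_of_nonpos fun k _ => by
        have := hterm k; have := hterm' k; omega).1
        (le_antisymm (Finset.sum_nonpos fun k _ => by
          have := hterm k; have := hterm' k; omega) h) ⟨0, hn⟩ (Finset.mem_univ _)
      have h1 := hterm ⟨0, hn⟩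
      have h2 := hterm' ⟨0, hn⟩
      have h3 := hadd ⟨0, hn⟩
      have h4 := ih x hx
      rw [← insertNth_add_unitVec_succAbove,
        ← intOdometer_swap i (i.succAbove ⟨0, hn⟩)] at h3
      rw [comp_swap_eq (by simp [hx1]), add_right_comm, add_sub_cancel_right] at h3
      omega

/-! ### Stabilisation and terminal values -/

lemma finite_hypercube (d N : ℕ) : (hypercube d N).Finite :=
  (Set.finite_Icc (fun _ : Fin d => 1 - ((N / 2 : ℕ) : ℤ))
    (fun _ => (((N + 1) / 2 : ℕ) : ℤ))).subset fun _ hx => ⟨fun i => (hx i).1, fun i => (hx i).2⟩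

lemma monotone_odometer (x : Fin d → ℤ) : Monotone fun t => odometer d N t x := fun s t h => by
  have := intOdometer_mono (d := d) (N := N) (x := x) h
  simpa [intOdometer] using this

lemma bddAbove_odometer (hd : 1 ≤ d) (x : Fin d → ℤ) :
    BddAbove (Set.range fun t => odometer d N t x) := by
  refine ⟨((N + 1) / 2) * ((N + 1) / 2 + 1), ?_⟩
  rintro _ ⟨t, rfl⟩
  by_cases hx : x ∈ hypercube d N
  · have h := two_mul_intOdometer_le (t := t) rfl hx ⟨0, hd⟩
    obtain ⟨b, hb⟩ := Int.even_mul_pred_self (x ⟨0, hd⟩)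
    have h1 : 0 ≤ x ⟨0, hd⟩ * (x ⟨0, hd⟩ - 1) := by
      rcases le_or_gt (x ⟨0, hd⟩) 0 with h | h <;> nlinarith
    have h2 : intOdometer d N t x = odometer d N t x := rfl
    have h3 : ((odometer d N t x : ℕ) : ℤ) ≤ ((((N + 1) / 2) * ((N + 1) / 2 + 1) : ℕ) : ℤ) := by
      rw [Nat.cast_mul, Nat.cast_add, Nat.cast_one]
      omega
    exact_mod_cast h3
  · have h := intOdometer_of_notMem (t := t) hx
    have h2 : intOdometer d N t x = odometer d N t x := rfl
    dsimp only
    have : odometer d N t x = 0 := by omega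
    rw [this]
    exact Nat.zero_le _

theorem eventually_odometer_eq (hd : 1 ≤ d) (N : ℕ) :
    ∀ᶠ t in Filter.atTop, odometer d N t = finalOdometer d N := by
  have hpt (x : Fin d → ℤ) : ∀ᶠ t in Filter.atTop, odometer d N t x = finalOdometer d N x := by
    have := tendsto_atTop_ciSup (monotone_odometer (N := N) x) (bddAbove_odometer hd x)
    rw [nhds_discrete, Filter.tendsto_pure] at this
    exact this
  have hfin := (Filter.eventually_all_finite (finite_hypercube d N)).2 fun x _ => hpt x
  filter_upwards [hfin] with t ht
  funext x
  by_cases hx : x ∈ hypercube d N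
  · exact ht x hx
  · have h (s : ℕ) : odometer d N s x = 0 := by
      have := intOdometer_of_notMem (t := s) hx
      have h2 : intOdometer d N s x = odometer d N s x := rfl
      omega
    simp [finalOdometer, h]

lemma intOdometer_eq_iff {d' N' : ℕ} {x : Fin d → ℤ} {y : Fin d' → ℤ} :
    intOdometer d N t x = intOdometer d' N' t y ↔ odometer d N t x = odometer d' N' t y := by
  simp [intOdometer]

lemma append_eq_insertNth (x : Fin n → ℤ) (a : ℤ) :
    append x a = (Fin.last n).insertNth (α := fun _ => ℤ) a x := by
  rw [Fin.insertNth_last']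
  rfl

theorem odometer_append_one (hN : 1 ≤ N) (hn : 1 ≤ n) (t : ℕ) {x : Fin n → ℤ}
    (hx : ∀ k, 1 ≤ x k) : odometer (n + 1) N t (append x 1) = odometer n N t x := by
  rw [append_eq_insertNth, ← intOdometer_eq_iff]
  exact intOdometer_insertNth_one hN hn _ t x hx

/-- Once `v` is terminal the one-step delay in the slope bound is void, so the drop from slice 1 to
slice 2 is zero. -/
theorem finalOdometer_append_two (hN : 1 ≤ N) (hn : 1 ≤ n) {x : Fin n → ℤ}
    (hx : ∀ k, 2 ≤ x k) : finalOdometer (n + 1) N (append x 2) = finalOdometer n N x := by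
  have hx1 (k : Fin n) : 1 ≤ x k := one_le_two.trans (hx k)
  have h1 := eventually_odometer_eq (Nat.le_add_left 1 n) N
  have h2 := (Filter.tendsto_add_atTop_nat 1).eventually h1
  obtain ⟨t, h1, h2, h3⟩ := (h1.and (h2.and (eventually_odometer_eq hn N))).exists
  have e : append x 2 = append x 1 + unitVec (Fin.last n) := by
    rw [append_eq_insertNth, append_eq_insertNth, insertNth_add_unitVec]
    rfl
  have hlast : append x 1 (Fin.last n) = 1 := by simp [append]
  have hle := intOdometer_add_le (N := N) (t := t) hlast.ge
  have hge := intOdometer_le_succ_add (N := N) t (append x 1) (i := Fin.last n)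
    (l := Fin.castSucc ⟨0, hn⟩) hlast.ge
    (by rw [hlast, append, Fin.snoc_castSucc]; have := hx ⟨0, hn⟩; omega)
  have hdr := odometer_append_one hN hn t hx1
  rw [← e] at hle hge
  simp only [intOdometer, h1, h2, hlast, h3] at hle hge hdr
  omega

/-! ### The one-dimensional process -/

/-- The one-dimensional odometer as a function on `ℤ`. -/
noncomputable def lineOdometer (N t : ℕ) (a : ℤ) : ℤ := intOdometer 1 N t fun _ => a

variable {a : ℤ}

lemma intOdometer_one_dim (x : Fin 1 → ℤ) : intOdometer 1 N t x = lineOdometer N t (x 0) := by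
  rw [lineOdometer]
  congr 1
  funext k
  rw [Subsingleton.elim k 0]

lemma latticeLaplacian_line : latticeLaplacian (intOdometer 1 N t) (fun _ => a) =
    lineOdometer N t (a + 1) + lineOdometer N t (a - 1) - 2 * lineOdometer N t a := by
  simp [latticeLaplacian, intOdometer_one_dim]

lemma mem_hypercube_line : (fun _ => a) ∈ hypercube 1 N ↔
    1 - ((N / 2 : ℕ) : ℤ) ≤ a ∧ a ≤ (((N + 1) / 2 : ℕ) : ℤ) := by
  simp [hypercube]

lemma lineOdometer_succ_cases (N t : ℕ) (a : ℤ) : lineOdometer N (t + 1) a = lineOdometer N t a ∨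
    lineOdometer N (t + 1) a = lineOdometer N t a + 1 := intOdometer_succ_cases

lemma lineOdometer_topples (h : lineOdometer N (t + 1) a ≠ lineOdometer N t a) :
    (1 - ((N / 2 : ℕ) : ℤ) ≤ a ∧ a ≤ (((N + 1) / 2 : ℕ) : ℤ)) ∧
    0 ≤ lineOdometer N t (a + 1) + lineOdometer N t (a - 1) - 2 * lineOdometer N t a := by
  have := topples_of_ne h
  rwa [latticeLaplacian_line, mem_hypercube_line] at this

lemma lineOdometer_succ_of (h1 : 1 - ((N / 2 : ℕ) : ℤ) ≤ a) (h2 : a ≤ (((N + 1) / 2 : ℕ) : ℤ))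
    (h : 0 ≤ lineOdometer N t (a + 1) + lineOdometer N t (a - 1) - 2 * lineOdometer N t a) :
    lineOdometer N (t + 1) a = lineOdometer N t a + 1 :=
  intOdometer_succ_of (mem_hypercube_line.2 ⟨h1, h2⟩) (latticeLaplacian_line ▸ h)

lemma lineOdometer_zero : lineOdometer N 0 a = 0 := intOdometer_zero

lemma lineOdometer_nonneg : 0 ≤ lineOdometer N t a := intOdometer_nonneg

lemma lineOdometer_succ_eq_iff : lineOdometer N (t + 1) a = t + 1 ↔
    1 - ((N / 2 : ℕ) : ℤ) + t ≤ a ∧ a ≤ (((N + 1) / 2 : ℕ) : ℤ) - t := by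
  rw [lineOdometer, intOdometer_succ_eq_iff]
  simp

lemma lineOdometer_add_one_le (h : 1 ≤ a) : lineOdometer N t (a + 1) ≤ lineOdometer N t a := by
  have := intOdometer_add_le (N := N) (t := t) (x := fun _ : Fin 1 => a) (i := 0) h
  simpa [intOdometer_one_dim] using this

lemma lineOdometer_le_add (h : 1 ≤ a) :
    lineOdometer N t a ≤ lineOdometer N t (a + 1) + a := by
  have := intOdometer_le_add (N := N) (t := t) (fun _ : Fin 1 => a) 0 h
  simpa [intOdometer_one_dim] using this

lemma lineOdometer_central_of_even (hN : N % 2 = 0) :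
    lineOdometer N t 0 = lineOdometer N t 1 := by
  have := intOdometer_sub_of_even (t := t) hN (x := fun _ : Fin 1 => 1) (i := 0) rfl
  simpa [intOdometer_one_dim] using this

lemma lineOdometer_central_of_odd (hN : N % 2 = 1) :
    lineOdometer N t 0 = lineOdometer N t 2 := by
  have := intOdometer_sub_of_odd (t := t) hN (x := fun _ : Fin 1 => 1) (i := 0) rfl
  simpa [intOdometer_one_dim] using this

/-- In one dimension the sites topple in a checkerboard pattern after their first rest. -/
theorem lineOdometer_parity {M : ℕ} (hM : M = (N + 1) / 2) (t : ℕ) (a : ℤ) (ha : 1 ≤ a)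
    (h : lineOdometer N (t + 1) a ≠ lineOdometer N t a) :
    lineOdometer N (t + 1) a = t + 1 ∨ (t + a - M) % 2 = 0 := by
  induction t generalizing a with
  | zero =>
    have := lineOdometer_succ_cases N 0 a
    rw [lineOdometer_zero] at this h
    left; omega
  | succ s ih =>
    by_contra! hc
    obtain ⟨hflat, hpar⟩ := hc
    have h1 := lineOdometer_succ_cases N s a
    have h2 := lineOdometer_succ_cases N (s + 1) a
    have hnflat : lineOdometer N (s + 1) a ≠ s + 1 := by push_cast at hflat; omega
    have hnc : lineOdometer N (s + 1 + 1) a ≤ lineOdometer N s a + 1 :=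
      (no_consecutive_topples s (fun _ : Fin 1 => a)).resolve_left hnflat
    have h3 : lineOdometer N (s + 1) a = lineOdometer N s a := by omega
    have h4 := lineOdometer_topples h
    have hQ : ¬ (1 - ((N / 2 : ℕ) : ℤ) + s ≤ a ∧ a ≤ (((N + 1) / 2 : ℕ) : ℤ) - s) :=
      fun h' => hnflat (lineOdometer_succ_eq_iff.2 h')
    -- Parity forbids the neighbours to topple at step `s`, and `a` rested then. Its Laplacian is
    -- unchanged, so `a` would have toppled at step `s` already.
    have hnb (b : ℤ) (hb : 1 ≤ b) (hab : b = a + 1 ∨ b = a - 1) :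
        lineOdometer N (s + 1) b = lineOdometer N s b := by
      by_contra hne
      rcases ih b hb hne with h5 | h5
      · have := lineOdometer_succ_eq_iff.1 h5
        push_cast at hpar
        omega
      · push_cast at hpar; omega
    have h5 := hnb (a + 1) (by omega) (Or.inl rfl)
    have h6 : lineOdometer N (s + 1) (a - 1) = lineOdometer N s (a - 1) := by
      rcases ha.eq_or_lt with rfl | h'
      · rcases Nat.mod_two_eq_zero_or_one N with hN | hN
        · rw [sub_self, lineOdometer_central_of_even hN, lineOdometer_central_of_even hN, h3]
        · rw [sub_self, lineOdometer_central_of_odd hN, lineOdometer_central_of_odd hN]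
          exact h5
      · exact hnb (a - 1) (by omega) (Or.inr rfl)
    have := lineOdometer_succ_of (t := s) h4.1.1 h4.1.2 (by omega)
    omega

/-- As long as the boundary has toppled fewer than `M` times, the slope bound improves by one
for the sites of the right parity. -/
theorem lineOdometer_le_add_of_boundary {M : ℕ} (t : ℕ)
    (hb : ∀ s ≤ t, lineOdometer (2 * M) s M < M) (a : ℤ) (ha : 1 ≤ a) (haM : a ≤ M)
    (hpar : (t + a - M) % 2 = 0) :
    lineOdometer (2 * M) t a ≤ lineOdometer (2 * M) t (a + 1) + a - 1 := by
  induction t generalizing a with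
  | zero => simp only [lineOdometer_zero]; omega
  | succ t ih =>
    push_cast at hpar
    rcases haM.eq_or_lt with rfl | haM'
    · have := hb (t + 1) le_rfl
      have := lineOdometer_nonneg (N := 2 * M) (t := t + 1) (a := (M : ℤ) + 1)
      omega
    have h1 := lineOdometer_succ_cases (2 * M) t a
    have h2 := lineOdometer_succ_cases (2 * M) t (a + 1)
    by_cases htop : lineOdometer (2 * M) (t + 1) a = lineOdometer (2 * M) t a
    -- A violation makes the drop at `a` equal to `a`; the induction hypothesis bounds the next drop
    -- by `a`, so `a + 1` topples and restores the bound.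
    · by_contra! hlt
      have h3 := lineOdometer_le_add (N := 2 * M) (t := t) ha
      have h4 := ih (fun s hs => hb s (by omega)) (a + 1) (by omega) (by omega) (by omega)
      have := lineOdometer_succ_of (N := 2 * M) (t := t) (a := a + 1) (by omega) (by omega)
        (by rw [add_sub_cancel_right]; omega)
      omega
    · have hflat := (lineOdometer_parity (M := M) (by omega) t a ha htop).resolve_right
        (by omega)
      have hQ := lineOdometer_succ_eq_iff.1 hflat
      by_cases h3 : a + 1 ≤ M - t
      · have := lineOdometer_succ_eq_iff (N := 2 * M) (t := t) (a := a + 1) |>.2 (by omega)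
        omega
      · rcases t with _ | t
        · have := lineOdometer_nonneg (N := 2 * M) (t := 0 + 1) (a := a + 1)
          push_cast at hflat
          omega
        · have := lineOdometer_succ_eq_iff (N := 2 * M) (t := t) (a := a + 1) |>.2 (by
            push_cast at *; omega)
          push_cast at *
          omega

/-- Self-similarity in one dimension. -/
theorem lineOdometer_self_similar {M j T : ℕ} (hM : M = (N + 1) / 2) (hj : j < M)
    (hT : ∀ s < T, lineOdometer (2 * j) s j < j) (t : ℕ) (ht : t ≤ T) (a : ℤ)
    (ha : (M : ℤ) - j < a) : lineOdometer N t a = lineOdometer (2 * j) t (a - (M - j)) := by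
  induction t generalizing a with
  | zero => simp only [lineOdometer_zero]
  | succ t ih =>
    have ih := ih (by omega)
    have h0 := ih a ha
    have h1 := ih (a + 1) (by omega)
    have hc := lineOdometer_succ_cases N t a
    have hc' := lineOdometer_succ_cases (2 * j) t (a - (M - j))
    rw [show a + 1 - ((M : ℤ) - j) = a - (M - j) + 1 by ring] at h1
    -- At the cut, the left neighbour in the small interval mirrors site 1, while in the large one
    -- it is at least as large: only the large process could topple alone.
    rcases (Int.add_one_le_iff.2 ha).eq_or_lt with h | h
    · have e : a - (M - j) = 1 := by omega
      rw [e] at h0 h1 hc' ⊢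
      have hcen := lineOdometer_central_of_even (N := 2 * j) (t := t) (by omega)
      have hmon := lineOdometer_add_one_le (N := N) (t := t) (a := a - 1) (by omega)
      rw [sub_add_cancel] at hmon
      by_cases h2 : lineOdometer (2 * j) (t + 1) 1 = lineOdometer (2 * j) t 1
      · by_contra hne
        have h3 : lineOdometer N (t + 1) a ≠ lineOdometer N t a := by omega
        have hmem := lineOdometer_topples h3
        have hj1 : (1 : ℤ) ≤ j := by omega
        have hmon2 := lineOdometer_add_one_le (N := 2 * j) (t := t) (a := 1) le_rfl
        rcases lineOdometer_parity hM t a (by omega) h3 with h4 | h4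
        · have h5 := lineOdometer_succ_eq_iff.1 h4
          have h6 := (lineOdometer_succ_eq_iff (N := 2 * j) (t := t) (a := 1)).2 (by omega)
          omega
        -- The checkerboard gives `t + 1 ≡ j` mod 2, so the improved slope bound at site 1 allows no
        -- drop, and the small process topples too.
        · have h5 := lineOdometer_le_add_of_boundary t (fun s hs => hT s (by omega)) 1 le_rfl hj1
            (by omega)
          have h6 := lineOdometer_succ_of (N := 2 * j) (t := t) (a := 1) (by omega) (by omega)
            (by rw [sub_self]; omega)
          omega
      · have h3 := lineOdometer_topples h2
        rw [sub_self] at h3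
        have h4 := lineOdometer_succ_of (N := N) (t := t) (a := a) (by omega) (by omega) (by omega)
        omega
    · have h2 := ih (a - 1) (by omega)
      rw [show a - 1 - ((M : ℤ) - j) = a - (M - j) - 1 by ring] at h2
      by_cases h3 : lineOdometer N (t + 1) a = lineOdometer N t a
      · by_contra hne
        have h4 := lineOdometer_topples (N := 2 * j) (t := t) (a := a - (M - j)) (by omega)
        have h5 := lineOdometer_succ_of (N := N) (t := t) (a := a) (by omega) (by omega) (by omega)
        omega
      · have h4 := lineOdometer_topples h3
        have h5 := lineOdometer_succ_of (N := 2 * j) (t := t) (a := a - (M - j)) (by omega)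
          (by omega) (by omega)
        omega

/-- The boundary of the interval of length `2j` eventually topples `j` times. -/
theorem exists_le_lineOdometer (j : ℕ) : ∃ t, (j : ℤ) ≤ lineOdometer (2 * j) t j := by
  rcases Nat.eq_zero_or_pos j with rfl | hj
  · exact ⟨0, lineOdometer_nonneg⟩
  have h1 := eventually_odometer_eq le_rfl (2 * j)
  obtain ⟨t, h1, h2⟩ := (h1.and ((Filter.tendsto_add_atTop_nat 1).eventually h1)).exists
  refine ⟨t, ?_⟩
  have hstable (a : ℤ) : lineOdometer (2 * j) (t + 1) a = lineOdometer (2 * j) t a := by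
    simp [lineOdometer, intOdometer, h1, h2]
  have hneg (a : ℤ) (h1 : 1 ≤ a) (h2 : a ≤ j) : lineOdometer (2 * j) t (a + 1) +
      lineOdometer (2 * j) t (a - 1) - 2 * lineOdometer (2 * j) t a < 0 := by
    by_contra! h
    have := lineOdometer_succ_of (N := 2 * j) (by omega) (by omega) h
    have := hstable a
    omega
  -- Terminal second differences are negative; summing them from the symmetric centre makes the drop
  -- at `k` at least `k`.
  have hslope (k : ℕ) (hk : 1 ≤ k) (hkj : k ≤ j) :
      lineOdometer (2 * j) t (k + 1) + k ≤ lineOdometer (2 * j) t k := by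
    induction k, hk using Nat.le_induction with
    | base =>
      have := hneg 1 le_rfl (by omega)
      rw [sub_self, lineOdometer_central_of_even (by omega)] at this
      rw [Nat.cast_one]
      omega
    | succ k hk ih =>
      have := hneg (k + 1) (by omega) (by omega)
      rw [add_sub_cancel_right] at this
      have := ih (by omega)
      push_cast
      omega
  have := hslope j hj le_rfl
  have := lineOdometer_nonneg (N := 2 * j) (t := t) (a := (j : ℤ) + 1)
  omega

/-! ### Self-similarity in every dimension -/

lemma insertNth_eq_self {n : ℕ} {i : Fin (n + 1)} {a : ℤ} {x : Fin (n + 1) → ℤ} (h : x i = a) :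
    i.insertNth (α := fun _ => ℤ) a (fun k => x (i.succAbove k)) = x := by
  funext k
  refine Fin.succAboveCases i ?_ (fun k => ?_) k <;> simp [h]

/-- `SelfSimilar d N j T`: up to time `T` the odometer on the hypercube of side `N` agrees near
the corner with the odometer on the hypercube of side `2 * j`. -/
def SelfSimilar (d N j T : ℕ) : Prop :=
  ∀ t ≤ T, ∀ x : Fin d → ℤ, (∀ i, (((N + 1) / 2 : ℕ) : ℤ) - j < x i) →
    intOdometer d N t x =
      intOdometer d (2 * j) t fun i => x i - ((((N + 1) / 2 : ℕ) : ℤ) - j)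

/-- One-step self-similarity passes to the next dimension. -/
theorem SelfSimilar.succ_dim {n j T : ℕ} (hn : 1 ≤ n) (hj : 1 ≤ j) (hN : (N + 1) / 2 = j + 1)
    (h : SelfSimilar n N j T) : SelfSimilar (n + 1) N j T := by
  have hshift : (((N + 1) / 2 : ℕ) : ℤ) - j = 1 := by omega
  unfold SelfSimilar at h ⊢
  rw [hshift] at h ⊢
  intro t
  induction t with
  | zero => intro _ x _; simp only [intOdometer_zero]
  | succ t ih =>
    intro ht x hx
    have ih := ih (by omega)
    refine intOdometer_succ_congr (ih x hx) (forall_congr' fun k => ?_) fun _ => ?_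
    · have := hx k
      dsimp only
      omega
    refine Eq.to_iff (congrArg _ (Finset.sum_congr rfl fun k _ => ?_))
    have e1 : (fun i => (x + unitVec k) i - 1) = (fun i => x i - 1) + unitVec k := by
      funext a; simp only [Pi.add_apply]; ring
    have e2 : (fun i => (x - unitVec k) i - 1) = (fun i => x i - 1) - unitVec k := by
      funext a; simp only [Pi.sub_apply]; ring
    have h1 := ih (x + unitVec k) fun i => by
      have h0 : (0 : ℤ) ≤ unitVec k i := by
        simp only [unitVec, Pi.single_apply]; split_ifs <;> simp
      have := hx i
      rw [Pi.add_apply]; omega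
    have h2 : intOdometer (n + 1) N t (x - unitVec k) =
        intOdometer (n + 1) (2 * j) t ((fun i => x i - 1) - unitVec k) := by
      -- If `x k = 2`, the neighbour lies on the central slice of the large cube; in the small cube
      -- it reflects onto the central slice. Both slices are `n`-dimensional odometers, matched by
      -- `h`.
      rcases (Int.add_one_le_iff.2 (hx k)).eq_or_lt with hk | hk
      · have hk1 : (fun i => x i - 1) k = 1 := by simp [← hk]
        rw [intOdometer_sub_of_even (Nat.mul_mod_right 2 j) hk1, ← insertNth_eq_self (x := fun i => x i - 1) hk1,
          intOdometer_insertNth_one (by omega) hn _ _ _ fun i => by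
            have := hx (k.succAbove i); omega]
        have hk2 : (x - unitVec k) k = 1 := by simp [← hk]
        rw [← insertNth_eq_self hk2,
          intOdometer_insertNth_one (by omega) hn _ _ _ fun i => by
            have := hx (k.succAbove i); simp; omega, h t (by omega)]
        · simp
        · intro i; simpa using hx (k.succAbove i)
      · rw [ih, e2]
        intro i
        by_cases hi : i = k
        · subst hi; simp; omega
        · simpa [hi] using hx i
    rw [h1, h2, e1, ih x hx]

lemma SelfSimilar.trans {d j k T : ℕ} (hjk : j ≤ k)
    (h1 : SelfSimilar d N k T) (h2 : SelfSimilar d (2 * k) j T) : SelfSimilar d N j T := by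
  intro t ht x hx
  rw [h1 t ht x fun i => by have := hx i; omega, h2 t ht _ fun i => by have := hx i; omega]
  congr 1
  funext i
  rw [show (2 * k + 1) / 2 = k by omega]
  ring

theorem selfSimilar_one {j T : ℕ} (hj : j < (N + 1) / 2)
    (hT : ∀ s < T, lineOdometer (2 * j) s j < j) : SelfSimilar 1 N j T := fun t ht x hx => by
  rw [intOdometer_one_dim, lineOdometer_self_similar rfl hj hT t ht _ (hx 0), intOdometer_one_dim]

/-- Self-similarity in every dimension. -/
theorem selfSimilar {n j T : ℕ} (hn : 1 ≤ n) (hj : 1 ≤ j)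
    (hT : ∀ s < T, lineOdometer (2 * j) s j < j) (hN : j < (N + 1) / 2) :
    SelfSimilar n N j T := by
  have hstep (n : ℕ) (hn : 1 ≤ n) (k : ℕ) (hk : j ≤ k) (N : ℕ) (hN : (N + 1) / 2 = k + 1) :
      SelfSimilar n N k T := by
    -- One-dimensional self-similarity identifies the end values of the two intervals, so this one
    -- stays below `j ≤ k`.
    have hT' : ∀ s < T, lineOdometer (2 * k) s k < k := fun s hs => by
      rcases hk.eq_or_lt with rfl | hk
      · exact hT s hs
      · have := lineOdometer_self_similar (N := 2 * k) (M := k) (by omega) hk hT s hs.le k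
          (by omega)
        rw [this, sub_sub_cancel]
        have := hT s hs
        omega
    induction n, hn using Nat.le_induction with
    | base => exact selfSimilar_one (by omega) hT'
    | succ n hn ih => exact ih.succ_dim hn (by omega) hN
  obtain ⟨m, hm⟩ : ∃ m, (N + 1) / 2 = m + 1 := ⟨(N + 1) / 2 - 1, by omega⟩
  have hjm : j ≤ m := by omega
  clear hN
  induction m, hjm using Nat.le_induction generalizing N with
  | base => exact hstep n hn j le_rfl N hm
  | succ m hjm ih =>
    exact (hstep n hn (m + 1) (by omega) N hm).trans (by omega) (ih (N := 2 * (m + 1)) (by omega))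

/-! ### The stopping times -/

/-- The boundary site `(j, 1, …, 1)` carries the one-dimensional boundary value. -/
lemma exists_innerBoundary_eq_line {j : ℕ} (hj : 1 ≤ j) {d : ℕ} (hd : 1 ≤ d) :
    ∃ x ∈ innerBoundary d (2 * j), (∀ k, 1 ≤ x k) ∧
      ∀ t, intOdometer d (2 * j) t x = lineOdometer (2 * j) t j := by
  suffices h : ∃ x ∈ hypercube d (2 * j), (∃ k, x k = j) ∧ (∀ k, 1 ≤ x k) ∧
      ∀ t, intOdometer d (2 * j) t x = lineOdometer (2 * j) t j by
    obtain ⟨x, hx, ⟨k, hk⟩, h1, h2⟩ := h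
    refine ⟨x, ⟨hx, x + unitVec k, fun h => ?_, ?_⟩, h1, h2⟩
    · have := (h k).2
      simp [hk] at this
      omega
    · simp only [Pi.add_apply, add_sub_cancel_left]
      simp [Pi.single_apply, apply_ite abs]
  induction d, hd using Nat.le_induction with
  | base =>
    exact ⟨fun _ => j, mem_hypercube_line.2 (by omega), ⟨0, rfl⟩, fun _ => by simpa, fun _ => rfl⟩
  | succ n hn ih =>
    obtain ⟨x, hx, ⟨k, hk⟩, h1, h2⟩ := ih
    refine ⟨(0 : Fin (n + 1)).insertNth (α := fun _ => ℤ) 1 x,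
      (Fin.forall_iff_succAbove 0).2 ⟨?_, fun i => ?_⟩, ⟨(0 : Fin (n + 1)).succAbove k, ?_⟩,
      (Fin.forall_iff_succAbove 0).2 ⟨?_, fun i => ?_⟩, fun t => ?_⟩
    · rw [Fin.insertNth_apply_same]; omega
    · rw [Fin.insertNth_apply_succAbove]; exact hx i
    · rw [Fin.insertNth_apply_succAbove, hk]
    · rw [Fin.insertNth_apply_same]
    · rw [Fin.insertNth_apply_succAbove]; exact h1 i
    · rw [intOdometer_insertNth_one (by omega) hn _ _ _ h1, h2]

lemma tau_le {d j t : ℕ} (ht : 1 ≤ t) {x : Fin d → ℤ} (hx : x ∈ innerBoundary d (2 * j))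
    (h : j ≤ odometer d (2 * j) t x) : tau d j ≤ t :=
  iInf₂_le t ⟨ht, x, hx, h⟩

theorem tau_ne_top {d j : ℕ} (hd : 1 ≤ d) (hj : 1 ≤ j) : tau d j ≠ ⊤ := by
  obtain ⟨x, hx, -, h⟩ := exists_innerBoundary_eq_line hj hd
  obtain ⟨t, ht⟩ := exists_le_lineOdometer j
  have ht' := ht.trans (intOdometer_mono (x := fun _ : Fin 1 => (j : ℤ)) (Nat.le_add_right t 1))
  have h1 : j ≤ odometer d (2 * j) (t + 1) x := by
    have h2 : intOdometer d (2 * j) (t + 1) x = odometer d (2 * j) (t + 1) x := rfl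
    have h3 := h (t + 1)
    rw [lineOdometer] at h3
    omega
  exact ne_top_of_le_ne_top (ENat.natCast_ne_top (t + 1)) (tau_le (by omega) hx h1)

/-- The site `(j, 1, …, 1)` competes in the definition of `tau`, so `tau` cannot exceed the
one-dimensional threshold time. -/
lemma lineOdometer_lt_of_lt_tau {d j s : ℕ} (hd : 1 ≤ d) (hj : 1 ≤ j) (hs : (s : ℕ∞) < tau d j) :
    lineOdometer (2 * j) s j < j := by
  by_contra! hle
  obtain ⟨x, hx, -, h⟩ := exists_innerBoundary_eq_line hj hd
  rcases Nat.eq_zero_or_pos s with rfl | hs0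
  · rw [lineOdometer_zero] at hle; omega
  have h2 : intOdometer d (2 * j) s x = odometer d (2 * j) s x := rfl
  have h3 := h s
  exact absurd (tau_le hs0 hx (by omega)) (not_le.2 hs)

end Sandpile

/-- The ambient dimension is `d = n + 1 ≥ 2`, and `M = ⌈N/2⌉ = (N + 1) / 2`. -/
theorem theorem1 (N n M : ℕ) (hN : 1 ≤ N) (hn : 1 ≤ n) (hM : M = (N + 1) / 2) :
    -- dimensional reduction on the central slice
    (∀ t : ℕ, 1 ≤ t → ∀ x ∈ Sandpile.sortedDomain n M,
      Sandpile.odometer (n + 1) N t (Sandpile.append x 1) = Sandpile.odometer n N t x) ∧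
    -- both processes stop, so that the suprema below are the terminal values
    (∀ᶠ t in Filter.atTop, Sandpile.odometer (n + 1) N t = Sandpile.finalOdometer (n + 1) N) ∧
    (∀ᶠ t in Filter.atTop, Sandpile.odometer n N t = Sandpile.finalOdometer n N) ∧
    -- dimensional reduction of the final odometer on the next slice
    (∀ x ∈ Sandpile.sortedDomain n M, (∀ i, 2 ≤ x i) →
      Sandpile.finalOdometer (n + 1) N (Sandpile.append x 2) = Sandpile.finalOdometer n N x) ∧
    -- self-similarity
    (∀ j : ℕ, j < M →
      (1 ≤ j → Sandpile.tau (n + 1) j ≠ ⊤) ∧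
      ∀ t : ℕ, (t : ℕ∞) ≤ Sandpile.tau (n + 1) j →
        ∀ x ∈ Sandpile.sortedDomain (n + 1) M, (∀ i, (M : ℤ) - j < x i) →
          Sandpile.odometer (n + 1) N t x =
            Sandpile.odometer (n + 1) (2 * j) t (fun i => x i - ((M : ℤ) - j))) := by
  refine ⟨fun t _ x hx => Sandpile.odometer_append_one hN hn t fun k => (hx.2 k).1,
    Sandpile.eventually_odometer_eq (by omega) N, Sandpile.eventually_odometer_eq hn N,
    fun x _ hx => Sandpile.finalOdometer_append_two hN hn hx,
    fun j hj => ⟨Sandpile.tau_ne_top (by omega), fun t ht x hx hxj => ?_⟩⟩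
  subst hM
  rcases Nat.eq_zero_or_pos j with rfl | hj0
  · have h1 := hxj 0
    have h2 := (hx.2 0).2
    push_cast at h1 h2
    omega
  · refine Sandpile.intOdometer_eq_iff.1 (Sandpile.selfSimilar (T := t) (by omega) hj0
      (fun s hs => Sandpile.lineOdometer_lt_of_lt_tau (d := n + 1) (by omega) hj0
        (lt_of_lt_of_le (by exact_mod_cast hs) ht)) hj t le_rfl x hxj)
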